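/- **Setting.** A network $G=(V,E,s,t,c,e)$ consists of a finite set $V$, a symmetric edge set $E\subset V\times V$, a source and a sink $s\neq t$ in $V$, capacities $c\colon E\to\mathbb{N}_0$ and excesses $e\colon V\setminus\{s,t\}\to\mathbb{N}_0$ (with $e(s)=\infty$, $e(t)=0$). For an antisymmetric $f\colon E\to\mathbb{Z}$ the residual network $G_f$ has capacities $c_f=c-f$ and excesses $e_f(v)=e(v)+\sum_{u:(u,v)\in E}f(u,v)$ for $v\neq t$. We write $u\to Y$ if some vertex of $Y$ can be reached from $u$ by a path (possibly of length $0$) of edges of positive capacity. Let $(R_k)_{k=1}^K$ be a partition of $V\setminus\{s,t\}$ into regions. For a region $R$ let $B^R=\{w\notin R\cup\{s,t\} : (u,w)\in E \text{ for some } u\in R\}$; put $\mathcal{B}=\bigcup_k B^{R_k}$ and $d^\infty=|\mathcal{B}|$. The region network $G^R$ has vertices $R\cup B^R\cup\{s,t\}$ and the edges of $E$ inside $R\cup\{s,t\}$ and between $R$ and $B^R$ in either direction; it inherits $c$ and $e|_{R\cup\{s,t\}}$, except that edges from $B^R$ to $R$ get capacity $0$. A vertex $v\neq s,t$ is active if $e(v)>0$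 and $d(v)<d^\infty$. **ARD$(G^R,d)$.** Start with $f=0$. For $k=0,1,\dots,d^\infty$, let $T_k=\{t\}\cup\{v\in B^R: d(v)<k\}$ and, as long as possible, choose any simple path $(v_0,\dots,v_l)$ of edges of positive residual capacity in $G^R_f$ with $v_0\in R$, $e_f(v_0)>0$, $v_l\in T_k$, and augment $f$ along it by $\min(e_f(v_0),\min_i c_f(v_{i-1},v_i))$ units. Let $f'$ be the final flow. The labels are $d'(u)=\min\{k: u\to T_k \text{ in } G^R_{f'}\}$ if $u\in R$ and $u\to T_{d^\infty}$, $d'(u)=d^\infty$ if $u\in R$ and $u\nrightarrow T_{d^\infty}$, and $d'=d$ on $B^R$. Return $(f',d')$. **P-ARD.** Initially, saturate all edges from $s$ to other vertices and replace $G$ by the residual network; set $d(s)=d^\infty$ and $d(v)=0$ for $v\neq s$. While there are active vertices, perform a sweep: 1. compute $(f'_k,d'_k)=\mathrm{ARD}(G^{R_k},d)$ for all $k$ concurrently; 2. fuse the labels: $d'=d'_k$ on $R_k$ for all $k$, and $d'=d$ on $\{s,t\}$; 3. with $\alpha(u,v)=1$ if $d'(u)\le d'(v)+1$ and $\alpha(u,v)=0$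 otherwise, fuse the flows: $f'(u,v)=\alpha(v,u)f'_k(u,v)+\alpha(u,v)f'_j(u,v)$ on edges from $R_k$ to $R_j$ with $j\neq k$; $f'=f'_k$ on edges inside $R_k$ and on edges between $R_k$ and $\{s,t\}$; $f'=0$ on edges joining $s$ and $t$; 4. replace $G$ by $G_{f'}$ and $d$ by $d'$; 5. optionally apply the global gap heuristic: if for some $g>0$ no vertex has label $g$, set all labels greater than $g$ to $d^\infty$. **Theorem.** For every network and every partition into regions, and for all choices made in the augmentations and in the optional steps, P-ARD terminates after at most $2|\mathcal{B}|^2+1$ sweeps. In particular every sweep itself terminates: no sequence of augmentations in a stage of ARD is infinite, and every sweep that is started produces a next state. -/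

import Mathlib

namespace PARD

/-- A network `(V, E, s, t, c, e)`. The edge relation is symmetric, and `c u v` is meaningful only on
edges. The values of `e` at `s` and `t` are never read (the convention is `e s = ∞`, `e t = 0`).
Capacities and excesses are integers; that they are nonnegative is the predicate `Network.Nonneg`. -/
structure Network (V : Type*) where
  E : V → V → Prop
  symm : ∀ u v, E u v → E v u
  s : V
  t : V
  s_ne_t : s ≠ t
  c : V → V → ℤ
  e : V → ℤ

namespace Network

/-- Capacities and excesses lie in `{0, 1, 2, …}`. -/
def Nonneg {V : Type*} (N : Network V) : Prop :=
  (∀ u v, N.E u v → 0 ≤ N.c u v) ∧ ∀ v, v ≠ N.s → v ≠ N.t → 0 ≤ N.e v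

open Classical in
/-- The residual network `G_f`: `c_f = c - f`, and `e_f(v) = e(v) + ∑ f(u,v)` over edges `(u,v)`. -/
noncomputable def residual {V : Type*} [Fintype V] (N : Network V) (f : V → V → ℤ) : Network V where
  E := N.E
  symm := N.symm
  s := N.s
  t := N.t
  s_ne_t := N.s_ne_t
  c := fun u v => N.c u v - f u v
  e := fun v => N.e v + ∑ u with N.E u v, f u v

/-- `(u,v)` is an edge of strictly positive capacity. -/
def Pos {V : Type*} (N : Network V) (u v : V) : Prop := N.E u v ∧ 0 < N.c u v

/-- `u → Y`: some vertex of `Y` is reachable from `u` by a path (possibly of length `0`) of edges of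
strictly positive capacity. -/
def Reaches {V : Type*} (N : Network V) (u : V) (Y : Set V) : Prop :=
  ∃ y ∈ Y, Relation.ReflTransGen N.Pos u y

/-- The boundary of a region `A`. -/
def bdry {V : Type*} (N : Network V) (A : Set V) : Set V :=
  {w | (∃ u ∈ A, N.E u w) ∧ w ∉ A ∧ w ≠ N.s ∧ w ≠ N.t}

open Classical in
/-- The region network of `A`, with vertex set `A ∪ bdry A ∪ {s,t}`: its edges are the edges inside
`A ∪ {s,t}` and those between `A` and its boundary in either direction; the edges from the boundary
into `A` have capacity `0`. Vertices of `V` outside the vertex set of the region network are isolated. -/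
noncomputable def region {V : Type*} (N : Network V) (A : Set V) : Network V where
  E := fun u v => N.E u v ∧
    ((u ∈ A ∪ {N.s, N.t} ∧ v ∈ A ∪ {N.s, N.t}) ∨ (u ∈ A ∧ v ∈ N.bdry A) ∨ (u ∈ N.bdry A ∧ v ∈ A))
  symm := by
    rintro u v ⟨h, h'⟩
    exact ⟨N.symm u v h, by tauto⟩
  s := N.s
  t := N.t
  s_ne_t := N.s_ne_t
  c := fun u v => if u ∈ N.bdry A ∧ v ∈ A then 0 else N.c u v
  e := fun v => if v ∈ A ∪ {N.s, N.t} then N.e v else 0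

end Network

/-- The regions `R 0, …, R (K-1)` are disjoint with union `V \ {s,t}`. -/
def IsRegionPartition {V : Type*} (N : Network V) {K : ℕ} (R : Fin K → Set V) : Prop :=
  (∀ j k, j ≠ k → Disjoint (R j) (R k)) ∧ ∀ v, (∃ k, v ∈ R k) ↔ v ≠ N.s ∧ v ≠ N.t

/-- The set `𝓑` of all boundary vertices. -/
def boundary {V : Type*} (N : Network V) {K : ℕ} (R : Fin K → Set V) : Set V :=
  ⋃ k, N.bdry (R k)

/-- The maximal label `d^∞ = |𝓑|`. -/
noncomputable def dInf {V : Type*} (N : Network V) {K : ℕ} (R : Fin K → Set V) : ℕ :=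
  (boundary N R).ncard

open Classical in
/-- The unit flow along the path `p 0, p 1, …, p l` (antisymmetric). -/
noncomputable def pathFlow {V : Type*} (p : ℕ → V) (l : ℕ) (u v : V) : ℤ :=
  (if ∃ i < l, p i = u ∧ p (i + 1) = v then 1 else 0) -
    (if ∃ i < l, p i = v ∧ p (i + 1) = u then 1 else 0)

/-- One iteration of `Augment(X, Y)` in the network `M`, with current flow `f`: along a simple path of
residual edges from a vertex of `X` with positive excess to a vertex of `Y`, push as many units as the
excess of the first vertex and the residual capacities of the edges allow. -/
def AugmentStep {V : Type*} [Fintype V] (M : Network V) (X Y : Set V) (f f' : V → V → ℤ) : Prop :=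
  ∃ (l : ℕ) (p : ℕ → V) (Δ : ℤ),
    Set.InjOn p (Set.Iic l) ∧ p 0 ∈ X ∧ p l ∈ Y ∧
    0 < (M.residual f).e (p 0) ∧
    (∀ i < l, (M.residual f).Pos (p i) (p (i + 1))) ∧
    IsLeast ({(M.residual f).e (p 0)} ∪ {x | ∃ i < l, x = (M.residual f).c (p i) (p (i + 1))}) Δ ∧
    f' = fun u v => f u v + Δ * pathFlow p l u v

/-- `Augment(X, Y)`, started with the flow `f`, can stop with the flow `f'`. -/
def Augment {V : Type*} [Fintype V] (M : Network V) (X Y : Set V) (f f' : V → V → ℤ) : Prop :=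
  Relation.ReflTransGen (AugmentStep M X Y) f f' ∧ ¬ ∃ f'', AugmentStep M X Y f' f''

/-- `Augment(X, Y)`, started with the flow `f`, always stops. -/
def AugmentTerminates {V : Type*} [Fintype V] (M : Network V) (X Y : Set V) (f : V → V → ℤ) : Prop :=
  Acc (fun g' g => AugmentStep M X Y g g') f

/-- The target set `T_k` of stage `k`. -/
def target {V : Type*} (N : Network V) (A : Set V) (d : V → ℕ) (k : ℕ) : Set V :=
  {N.t} ∪ {v | v ∈ N.bdry A ∧ d v < k}

/-- `ARDStages N A d k f`: in the region network of `A`, the flow can be `f` after the stages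
`0, …, k-1` of ARD, that is, at the beginning of stage `k`. -/
inductive ARDStages {V : Type*} [Fintype V] (N : Network V) (A : Set V) (d : V → ℕ) :
    ℕ → (V → V → ℤ) → Prop
  | zero : ARDStages N A d 0 (fun _ _ => 0)
  | succ {k : ℕ} {f f' : V → V → ℤ} : ARDStages N A d k f →
      Augment (N.region A) A (target N A d k) f f' → ARDStages N A d (k + 1) f'

open Classical in
/-- The region-relabel step of ARD, in the residual region network of the flow `f`. -/
noncomputable def regionRelabel {V : Type*} [Fintype V] (N : Network V) (A : Set V) (D : ℕ)
    (d : V → ℕ) (f : V → V → ℤ) (u : V) : ℕ :=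
  if u ∈ A then
    if ((N.region A).residual f).Reaches u (target N A d D) then
      sInf {k | ((N.region A).residual f).Reaches u (target N A d k)}
    else D
  else d u

/-- `(f', d')` is a possible output of ARD on the region network of `A` with labels `d`, where `D` is
the maximal label: stages `0, …, D`, followed by region-relabel. -/
def ARD {V : Type*} [Fintype V] (N : Network V) (A : Set V) (D : ℕ) (d : V → ℕ)
    (f' : V → V → ℤ) (d' : V → ℕ) : Prop :=
  ARDStages N A d (D + 1) f' ∧ d' = regionRelabel N A D d f'

/-- A state of the algorithm between sweeps: the current network and the current labels. -/
structure AlgState (V : Type*) where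
  net : Network V
  d : V → ℕ

open Classical in
/-- The preflow saturating all edges out of the source. -/
noncomputable def saturate {V : Type*} (N : Network V) (u v : V) : ℤ :=
  if u = N.s ∧ v ≠ N.s ∧ N.E u v then N.c u v
  else if v = N.s ∧ u ≠ N.s ∧ N.E v u then - N.c v u
  else 0

open Classical in
/-- `Init()`. -/
noncomputable def initState {V : Type*} [Fintype V] (N : Network V) {K : ℕ} (R : Fin K → Set V) :
    AlgState V where
  net := N.residual (saturate N)
  d := fun v => if v = N.s then dInf N R else 0

/-- There is an active vertex. The source (of label `d^∞`) and the sink (of excess `0`) never are. -/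
def HasActive {V : Type*} {K : ℕ} (R : Fin K → Set V) (S : AlgState V) : Prop :=
  ∃ v, v ≠ S.net.s ∧ v ≠ S.net.t ∧ 0 < S.net.e v ∧ S.d v < dInf S.net R

open Classical in
/-- `α(u,v) = [d'(u) ≤ d'(v) + 1]`. -/
noncomputable def validPair {V : Type*} (d' : V → ℕ) (u v : V) : ℤ :=
  if d' u ≤ d' v + 1 then 1 else 0

/-- `d'` is the labeling fused from the labelings `dk k` of the regions. -/
def FusedLabels {V : Type*} {K : ℕ} (R : Fin K → Set V) (d : V → ℕ) (dk : Fin K → V → ℕ)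
    (d' : V → ℕ) : Prop :=
  (∀ k, ∀ v ∈ R k, d' v = dk k v) ∧ ∀ v, (∀ k, v ∉ R k) → d' v = d v

/-- `f'` is the flow fused from the flows `fk k` of the regions, with respect to the fused labels `d'`.
Besides the edges between two regions and the edges inside a region, there are the edges between a
region and the terminals, which belong to the network of that region only, and the edges joining the
two terminals, on which nothing is ever sent. -/
def FusedFlow {V : Type*} (N : Network V) {K : ℕ} (R : Fin K → Set V) (d' : V → ℕ)
    (fk : Fin K → V → V → ℤ) (f' : V → V → ℤ) : Prop :=
  (∀ k j, k ≠ j → ∀ u ∈ R k, ∀ v ∈ R j,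
    f' u v = validPair d' v u * fk k u v + validPair d' u v * fk j u v) ∧
  (∀ k, ∀ u ∈ R k, ∀ v ∈ R k, f' u v = fk k u v) ∧
  (∀ k, ∀ u ∈ R k, ∀ v, v = N.s ∨ v = N.t → f' u v = fk k u v ∧ f' v u = fk k v u) ∧
  (∀ u v, u = N.s ∨ u = N.t → v = N.s ∨ v = N.t → f' u v = 0)

open Classical in
/-- The (optional) global gap heuristic: either it is not applied, or no vertex has label `g > 0` and
all labels above `g` are raised to the maximal label `D`. -/
def GlobalGap {V : Type*} (D : ℕ) (d d' : V → ℕ) : Prop :=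
  d' = d ∨ ∃ g, 0 < g ∧ (∀ v, d v ≠ g) ∧ d' = fun v => if g < d v then D else d v

/-- One sweep of the parallel algorithm with ARD can lead from the state `S` to the state `S'`. -/
def Sweep {V : Type*} [Fintype V] {K : ℕ} (R : Fin K → Set V) (S S' : AlgState V) : Prop :=
  ∃ (fk : Fin K → V → V → ℤ) (dk : Fin K → V → ℕ) (f' : V → V → ℤ) (d' : V → ℕ),
    (∀ k, ARD S.net (R k) (dInf S.net R) S.d (fk k) (dk k)) ∧
    FusedLabels R S.d dk d' ∧
    FusedFlow S.net R d' fk f' ∧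
    S'.net = S.net.residual f' ∧
    GlobalGap (dInf S.net R) d' S'.d

/-- One iteration of the main loop: there are active vertices, and a sweep is made. -/
def LoopStep {V : Type*} [Fintype V] {K : ℕ} (R : Fin K → Set V) (S S' : AlgState V) : Prop :=
  HasActive R S ∧ Sweep R S S'

end PARD

/-! Write `D` for the maximal label `|𝓑|`, `L` for the sum of the labels over `𝓑`, and `M` for the
maximal label of an eligible vertex (`Eligible`). The bound comes from the potential `L - M`, which
grows by at least one in every sweep after the first that leaves an eligible vertex
(`Fusion.eligible_step`).

One call of ARD. Stage `k` ends with no region vertex of positive excess reaching `T_k`, and later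
augmentations cannot restore this reachability (`StageInv.step`). Hence leftover excess gets label
`D`; and if flow enters a boundary vertex `u`, it comes from a vertex `x` of positive excess that
still could not reach `T_{d(u)}`, so that `d(u) < d'(x)` (field `origin` of `ARDSpec`). Labels do
not decrease, and discarding flow by `α` keeps the fused labeling valid (`Fusion.validOn`).

One sweep. A vertex active after it got excess through fusion, so it lies in `𝓑`. Tracing an
eligible vertex back to the origin `x` of the flow responsible, `x` was eligible before the sweep,
and either `x` lies in `𝓑` or it had label `D`. The rise of `L` caused by the few vertices involved
exceeds the rise from the old label of `x` to the new label of the vertex traced. Eligibility has to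
include some vertices of label `D`: ARD augments from them too, so they can make other vertices
active again.

Counting. After the first sweep `L - M ≥ -D`, and before the last one `L < D²`, because some
boundary vertex is active. This leaves at most `D² + D + 1 ≤ 2D² + 1` sweeps (`sweeps_le`). A stage
of ARD stops because each augmentation removes at least one unit of excess from the region. -/

namespace PARD

/-! ### Unit flows along simple paths. -/

section PathFlow

variable {V : Type*} {p : ℕ → V} {l : ℕ}

open Classical in
theorem ite_exists_edge_eq_sum (hp : Set.InjOn p (Set.Iic l)) (u v : V) :
    (if ∃ i < l, p i = u ∧ p (i + 1) = v then (1 : ℤ) else 0) =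
      ∑ i ∈ Finset.range l, if p i = u ∧ p (i + 1) = v then (1 : ℤ) else 0 := by
  split_ifs with h
  · obtain ⟨i, hi, h1, h2⟩ := h
    rw [Finset.sum_eq_single i, if_pos ⟨h1, h2⟩]
    · intro j hj hji
      rw [if_neg]
      rintro ⟨h3, -⟩
      exact hji (hp (Set.mem_Iic.2 (Finset.mem_range.1 hj).le) (Set.mem_Iic.2 hi.le)
        (h3.trans h1.symm))
    · intro hi'
      exact absurd (Finset.mem_range.2 hi) hi'
  · symm
    apply Finset.sum_eq_zero
    intro i hi
    rw [if_neg]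
    intro h'
    exact h ⟨i, Finset.mem_range.1 hi, h'⟩

-- Summed along the path, the net inflow at `v` telescopes; simplicity ensures that each edge is
-- counted once.
open Classical in
theorem sum_pathFlow [Fintype V] (hp : Set.InjOn p (Set.Iic l)) (v : V) :
    ∑ u, pathFlow p l u v = (if p l = v then 1 else 0) - (if p 0 = v then 1 else 0) := by
  simp only [pathFlow, ite_exists_edge_eq_sum hp, Finset.sum_sub_distrib]
  rw [Finset.sum_comm, Finset.sum_comm (s := Finset.univ) (t := Finset.range l)]
  rw [← Finset.sum_sub_distrib, ← Finset.sum_range_sub (fun i => if p i = v then (1 : ℤ) else 0) l]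
  refine Finset.sum_congr rfl fun i _ => ?_
  congr 1
  · by_cases h : p (i + 1) = v <;> simp [h]
  · by_cases h : p i = v <;> simp [h]

theorem pathFlow_antisymm (u v : V) : pathFlow p l u v = -pathFlow p l v u := by
  simp only [pathFlow]; ring

theorem pathFlow_le_one (u v : V) : pathFlow p l u v ≤ 1 := by
  simp only [pathFlow]; split_ifs <;> norm_num

theorem exists_edge_of_pathFlow_pos {u v : V} (h : 0 < pathFlow p l u v) :
    ∃ i < l, p i = u ∧ p (i + 1) = v := by
  by_contra h'
  simp only [pathFlow, if_neg h'] at h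
  split_ifs at h <;> omega

end PathFlow

/-! ### Flows, single augmentations and reachability in the residual network. -/

section Flow

variable {V : Type*}

theorem Network.Reaches.mono {N : Network V} {u : V} {S T : Set V} (h : N.Reaches u S)
    (hST : S ⊆ T) : N.Reaches u T := by
  obtain ⟨y, hy, h⟩ := h
  exact ⟨y, hST hy, h⟩

theorem Network.Reaches.head {N : Network V} {u v : V} {T : Set V} (h : N.Pos u v)
    (hv : N.Reaches v T) : N.Reaches u T := by
  obtain ⟨y, hy, h'⟩ := hv
  exact ⟨y, hy, h'.head h⟩

theorem Network.Reaches.trans {N : Network V} {u v : V} {T : Set V}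
    (h : Relation.ReflTransGen N.Pos u v) (hv : N.Reaches v T) : N.Reaches u T := by
  obtain ⟨y, hy, h'⟩ := hv
  exact ⟨y, hy, h.trans h'⟩

theorem Network.reaches_of_mem {N : Network V} {u : V} {T : Set V} (h : u ∈ T) :
    N.Reaches u T := ⟨u, h, .refl⟩

/-- An antisymmetric function supported on the edges and respecting the capacities. -/
structure IsFlow (M : Network V) (f : V → V → ℤ) : Prop where
  antisymm : ∀ u v, f u v = -f v u
  support : ∀ u v, ¬ M.E u v → f u v = 0
  capacity : ∀ u v, M.E u v → f u v ≤ M.c u v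

theorem IsFlow.residual_e [Fintype V] {M : Network V} {f : V → V → ℤ} (hf : IsFlow M f) (v : V) :
    (M.residual f).e v = M.e v + ∑ u, f u v := by
  simp only [Network.residual]
  congr 1
  apply Finset.sum_subset (Finset.subset_univ _)
  intro u _ hu
  exact hf.support u v (by simpa using hu)

theorem reflTransGen_path {N : Network V} {p : ℕ → V} {l : ℕ}
    (h : ∀ i < l, N.Pos (p i) (p (i + 1))) {i j : ℕ} (hij : i ≤ j) (hj : j ≤ l) :
    Relation.ReflTransGen N.Pos (p i) (p j) := by
  induction j, hij using Nat.le_induction with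
  | base => exact .refl
  | succ j _ ih => exact (ih (by omega)).tail (h j (by omega))

/-- The effect of one augmentation. -/
structure Augmented [Fintype V] (M : Network V) (X Y : Set V) (f f' : V → V → ℤ) (x y : V)
    (Δ : ℤ) : Prop where
  flow : IsFlow M f'
  source_mem : x ∈ X
  target_mem : y ∈ Y
  pos : 0 < Δ
  le_excess : Δ ≤ M.e x + ∑ u, f u x
  reaches : Relation.ReflTransGen (M.residual f).Pos x y
  inflow_source : x ≠ y → ∑ u, f' u x = ∑ u, f u x - Δ
  inflow_target : x ≠ y → ∑ u, f' u y = ∑ u, f u y + Δ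
  inflow_other : ∀ v, v ≠ x → v ≠ y → ∑ u, f' u v = ∑ u, f u v
  reaches_anti : ∀ T, Y ⊆ T ∨ ¬ (M.residual f).Reaches x T →
    ∀ u, (M.residual f').Reaches u T → (M.residual f).Reaches u T

theorem AugmentStep.augmented [Fintype V] {M : Network V} {X Y : Set V} {f f' : V → V → ℤ}
    (hf : IsFlow M f) (h : AugmentStep M X Y f f') : ∃ x y Δ, Augmented M X Y f f' x y Δ := by
  obtain ⟨l, p, Δ, hp, hX, hY, he, hpath, hΔ, rfl⟩ := h
  have hpos : 0 < Δ := by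
    rcases hΔ.1 with h | ⟨i, hi, h⟩
    · rw [Set.mem_singleton_iff] at h; rw [h]; exact he
    · rw [h]; exact (hpath i hi).2
  have hle : Δ ≤ (M.residual f).e (p 0) := hΔ.2 (Or.inl rfl)
  have hcap : ∀ i < l, f (p i) (p (i + 1)) + Δ ≤ M.c (p i) (p (i + 1)) := by
    intro i hi
    have := hΔ.2 (Or.inr ⟨i, hi, rfl⟩)
    simp only [Network.residual] at this
    omega
  have hsum : ∀ v, ∑ u, (f u v + Δ * pathFlow p l u v) =
      ∑ u, f u v + Δ * ∑ u, pathFlow p l u v := by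
    intro v; rw [Finset.sum_add_distrib, Finset.mul_sum]
  have hedge : ∀ u v, pathFlow p l u v ≠ 0 → M.E u v := by
    intro u v huv
    rcases lt_or_gt_of_ne huv with h | h
    · rw [pathFlow_antisymm] at h
      obtain ⟨i, hi, rfl, rfl⟩ := exists_edge_of_pathFlow_pos (p := p) (l := l) (neg_lt_zero.1 h)
      exact M.symm _ _ (hpath i hi).1
    · obtain ⟨i, hi, rfl, rfl⟩ := exists_edge_of_pathFlow_pos h
      exact (hpath i hi).1
  refine ⟨p 0, p l, Δ, ⟨?_, ?_, ?_⟩, hX, hY, hpos, ?_, reflTransGen_path hpath (Nat.zero_le l) le_rfl,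
    ?_, ?_, ?_, ?_⟩
  · intro u v
    rw [hf.antisymm u v, pathFlow_antisymm u v]; ring
  · intro u v huv
    have : pathFlow p l u v = 0 := by
      by_contra h; exact huv (hedge u v h)
    simp only [this, hf.support u v huv]; ring
  · intro u v huv
    by_cases h : 0 < pathFlow p l u v
    · obtain ⟨i, hi, rfl, rfl⟩ := exists_edge_of_pathFlow_pos h
      have := hcap i hi
      have h1 := pathFlow_le_one (p := p) (l := l) (p i) (p (i + 1))
      nlinarith
    · have := hf.capacity u v huv
      nlinarith
  · rwa [hf.residual_e] at hle
  · intro hxy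
    rw [hsum, sum_pathFlow hp, if_neg (Ne.symm hxy), if_pos rfl]; ring
  · intro hxy
    rw [hsum, sum_pathFlow hp, if_neg hxy, if_pos rfl]; ring
  · intro v hx hy
    rw [hsum, sum_pathFlow hp, if_neg (Ne.symm hx), if_neg (Ne.symm hy)]; ring
  -- An edge that is residual only after the augmentation reverses a path edge, so it runs from `p
  -- (i + 1)` to `p i`. If `Y ⊆ T`, the rest of the old path already leads from `p (i + 1)` to `T`.
  -- Otherwise `p i` reaching `T` would let `p 0` reach `T`, which is excluded.
  · rintro T hT u ⟨y, hy, hu⟩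
    induction hu using Relation.ReflTransGen.head_induction_on with
    | refl => exact Network.reaches_of_mem hy
    | @head a b hab _ ih =>
      by_cases h : (M.residual f).Pos a b
      · exact .head h ih
      have hab' : pathFlow p l a b < 0 := by
        by_contra h0
        apply h
        refine ⟨hab.1, ?_⟩
        have := hab.2
        simp only [Network.residual] at this ⊢
        nlinarith
      rw [pathFlow_antisymm] at hab'
      obtain ⟨i, hi, rfl, rfl⟩ := exists_edge_of_pathFlow_pos (p := p) (l := l) (neg_lt_zero.1 hab')
      rcases hT with hT | hT
      · exact .trans (reflTransGen_path hpath (i := i + 1) hi le_rfl)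
          (Network.reaches_of_mem (hT hY))
      · exact absurd (.trans (reflTransGen_path hpath (Nat.zero_le i) hi.le) ih) hT

theorem exists_path_of_reflTransGen {r : V → V → Prop} {a b : V} (h : Relation.ReflTransGen r a b) :
    ∃ (l : ℕ) (p : ℕ → V), p 0 = a ∧ p l = b ∧ ∀ i < l, r (p i) (p (i + 1)) := by
  induction h with
  | refl => exact ⟨0, fun _ => a, rfl, rfl, by simp⟩
  | @tail b c _ hbc ih =>
    obtain ⟨l, p, h0, hl, hp⟩ := ih
    refine ⟨l + 1, fun i => if i ≤ l then p i else c, by simp [h0], by simp, ?_⟩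
    intro i hi
    rcases Nat.lt_succ_iff_lt_or_eq.1 hi with hi | rfl
    · simpa [hi.le, Nat.succ_le_of_lt hi] using hp i hi
    · simpa [hl] using hbc

theorem exists_simple_path {r : V → V → Prop} {a b : V} (h : Relation.ReflTransGen r a b) :
    ∃ (l : ℕ) (p : ℕ → V), Set.InjOn p (Set.Iic l) ∧ p 0 = a ∧ p l = b ∧
      ∀ i < l, r (p i) (p (i + 1)) := by
  classical
  have hex := exists_path_of_reflTransGen h
  obtain ⟨p, h0, hl, hp⟩ := Nat.find_spec hex
  have key : ∀ i j, i < j → j ≤ Nat.find hex → p i ≠ p j := by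
    intro i j hij hj heq
    -- A repeated vertex in a shortest path allows the loop between positions `i` and `j` to be cut
    -- out.
    refine Nat.find_min hex (m := Nat.find hex - (j - i)) (by omega)
      ⟨fun n => if n ≤ i then p n else p (n + (j - i)), by simp [h0], ?_, ?_⟩
    · have : Nat.find hex - (j - i) + (j - i) = Nat.find hex := by omega
      by_cases hc : Nat.find hex - (j - i) ≤ i
      · have hji : Nat.find hex = j := by omega
        simp only [hc, if_true]
        rw [show Nat.find hex - (j - i) = i by omega, heq, ← hji, hl]
      · simp only [hc, if_false, this, hl]
    · intro n hn
      rcases lt_trichotomy n i with hni | rfl | hni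
      · simpa [hni.le, Nat.succ_le_of_lt hni] using hp n (by omega)
      · have := hp j (by omega)
        simp only [le_refl, if_true, Nat.not_succ_le_self, if_false, heq]
        rwa [show n + 1 + (j - n) = j + 1 by omega]
      · have := hp (n + (j - i)) (by omega)
        simp only [show ¬ n ≤ i by omega, show ¬ n + 1 ≤ i by omega, if_false]
        rwa [show n + 1 + (j - i) = n + (j - i) + 1 by omega]
  refine ⟨_, p, ?_, h0, hl, hp⟩
  intro i hi j hj hij
  rcases lt_trichotomy i j with h | h | h
  · exact absurd hij (key i j h hj)
  · exact h
  · exact absurd hij.symm (key j i h hi)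

/-- Used contrapositively: when `Augment` has stopped, no vertex of `X` with positive excess reaches
`Y`. -/
theorem exists_augmentStep [Fintype V] {M : Network V} {X Y : Set V} {f : V → V → ℤ} {x : V}
    (hx : x ∈ X) (he : 0 < (M.residual f).e x) (hr : (M.residual f).Reaches x Y) :
    ∃ f', AugmentStep M X Y f f' := by
  obtain ⟨y, hy, hr⟩ := hr
  obtain ⟨l, p, hp, rfl, rfl, hpath⟩ := exists_simple_path hr
  have hfin : ({(M.residual f).e (p 0)} ∪
      {z | ∃ i < l, z = (M.residual f).c (p i) (p (i + 1))} : Set ℤ).Finite := by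
    refine (Set.finite_singleton _).union (((Set.finite_Iio l).image
      fun i => (M.residual f).c (p i) (p (i + 1))).subset ?_)
    rintro z ⟨i, hi, rfl⟩
    exact ⟨i, hi, rfl⟩
  obtain ⟨Δ, h⟩ := hfin.exists_minimal ⟨_, Or.inl rfl⟩
  refine ⟨_, l, p, Δ, hp, hx, hy, he, hpath, ⟨h.1, ?_⟩, rfl⟩
  intro z hz
  rcases le_total Δ z with h' | h'
  · exact h'
  · exact h.2 hz h'

end Flow

end PARD

namespace PARD

/-! ### Region networks and valid labelings. -/

section Region

variable {V : Type*} {N : Network V} {A : Set V} {D : ℕ} {d : V → ℕ}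

/-- The network is nonnegative and saturated at the source, and `d` is a valid labeling of the region
network of `A` with values at most `D`. -/
structure ValidOn (N : Network V) (A : Set V) (D : ℕ) (d : V → ℕ) : Prop where
  source_notMem : N.s ∉ A
  sink_notMem : N.t ∉ A
  cap_nonneg : ∀ u v, N.E u v → 0 ≤ N.c u v
  excess_nonneg : ∀ v ∈ A, 0 ≤ N.e v
  source_saturated : ∀ v, v ≠ N.s → N.E N.s v → N.c N.s v = 0
  le_max : ∀ v, v ≠ N.s → v ≠ N.t → d v ≤ D
  inner : ∀ u ∈ A, ∀ v ∈ A, N.Pos u v → d u ≤ d v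
  outer : ∀ u ∈ A, ∀ v ∈ N.bdry A, N.Pos u v → d u ≤ d v + 1
  sink : ∀ u ∈ A, N.Pos u N.t → d u = 0

theorem target_mono {j k : ℕ} (h : j ≤ k) : target N A d j ⊆ target N A d k := by
  rintro v (hv | hv)
  · exact Or.inl hv
  · exact Or.inr ⟨hv.1, hv.2.trans_le h⟩

theorem ValidOn.notMem_target (h : ValidOn N A D d) {v : V} (hv : v ∈ A) (k : ℕ) :
    v ∉ target N A d k := by
  rintro (rfl | h')
  · exact h.sink_notMem hv
  · exact h'.1.2.1 hv

theorem region_E_of_mem {u v : V} (hv : v ∈ A) : (N.region A).E u v ↔ N.E u v := by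
  refine ⟨fun h => h.1, fun h => ⟨h, ?_⟩⟩
  by_cases hu : u ∈ A ∪ {N.s, N.t}
  · exact Or.inl ⟨hu, Or.inl hv⟩
  · simp only [Set.mem_union, Set.mem_insert_iff, Set.mem_singleton_iff, not_or] at hu
    exact Or.inr (Or.inr ⟨⟨⟨v, hv, N.symm _ _ h⟩, hu⟩, hv⟩)

theorem region_E_of_mem_left {u v : V} (hu : u ∈ A) : (N.region A).E u v ↔ N.E u v :=
  ⟨fun h => h.1, fun h => (N.region A).symm _ _ ((region_E_of_mem hu).2 (N.symm _ _ h))⟩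

theorem region_c_of_notMem_bdry {u v : V} (hu : u ∉ N.bdry A) :
    (N.region A).c u v = N.c u v := by
  simp [Network.region, hu]

theorem region_c_of_mem {u v : V} (hu : u ∈ A) : (N.region A).c u v = N.c u v :=
  region_c_of_notMem_bdry fun h => h.2.1 hu

theorem region_c_of_mem_bdry {u v : V} (hu : u ∈ N.bdry A) (hv : v ∈ A) :
    (N.region A).c u v = 0 := by
  simp [Network.region, hu, hv]

theorem region_e_of_mem {v : V} (hv : v ∈ A) : (N.region A).e v = N.e v := by
  simp [Network.region, hv]

theorem region_pos_of_mem {u v : V} (hu : u ∈ A) : (N.region A).Pos u v ↔ N.Pos u v := by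
  simp only [Network.Pos, region_E_of_mem_left hu, region_c_of_mem hu]

theorem mem_of_region_E {u v : V} (hu : u ∈ N.bdry A) (h : (N.region A).E u v) : v ∈ A := by
  have h1 : u ∉ A := hu.2.1
  have h2 : u ∉ A ∪ {N.s, N.t} := by
    rintro (h | rfl | rfl)
    · exact h1 h
    · exact hu.2.2.1 rfl
    · exact hu.2.2.2 rfl
  rcases h.2 with h | h | h
  · exact absurd h.1 h2
  · exact absurd h.1 h1
  · exact h.2

theorem not_region_pos_of_mem_bdry {u v : V} (hu : u ∈ N.bdry A) : ¬ (N.region A).Pos u v := by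
  rintro ⟨h, h'⟩
  rw [region_c_of_mem_bdry hu (mem_of_region_E hu h)] at h'
  exact lt_irrefl _ h'

theorem mem_target_of_region_reaches {k : ℕ} {u : V} (hu : u ∈ N.bdry A)
    (h : (N.region A).Reaches u (target N A d k)) : d u < k := by
  obtain ⟨y, hy, h⟩ := h
  rcases h.cases_head with rfl | ⟨v, hv, _⟩
  · rcases hy with rfl | hy
    · exact absurd rfl hu.2.2.2
    · exact hy.2
  · exact absurd hv (not_region_pos_of_mem_bdry hu)

/-- A path of the region network from a region vertex to the target set leaves the region along an
edge to the sink or to a target vertex of the boundary. -/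
theorem ValidOn.exists_exit (h : ValidOn N A D d) {k : ℕ} {z : V} (hz : z ∈ A)
    (hr : (N.region A).Reaches z (target N A d k)) :
    ∃ u ∈ A, Relation.ReflTransGen (fun a b => a ∈ A ∧ b ∈ A ∧ N.Pos a b) z u ∧
      (N.Pos u N.t ∨ ∃ w ∈ N.bdry A, d w < k ∧ N.Pos u w) := by
  obtain ⟨y, hy, hr⟩ := hr
  -- The induction needs more: the path avoids the source, whose outgoing edges are saturated, and
  -- can meet the boundary only at its end, because no edge of positive capacity leaves a boundary
  -- vertex.
  suffices H : z ≠ N.s ∧ (z ∈ N.bdry A → d z < k) ∧ (z ∈ A →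
      ∃ u ∈ A, Relation.ReflTransGen (fun a b => a ∈ A ∧ b ∈ A ∧ N.Pos a b) z u ∧
      (N.Pos u N.t ∨ ∃ w ∈ N.bdry A, d w < k ∧ N.Pos u w)) from H.2.2 hz
  clear hz
  induction hr using Relation.ReflTransGen.head_induction_on with
  | refl =>
    refine ⟨?_, ?_, fun hy' => absurd hy (h.notMem_target hy' k)⟩
    · rintro rfl
      rcases hy with hy | hy
      · exact N.s_ne_t hy
      · exact hy.1.2.2.1 rfl
    · intro hb
      exact mem_target_of_region_reaches hb (Network.reaches_of_mem hy)
  | @head a b hab _ ih =>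
    refine ⟨?_, fun ha => absurd hab (not_region_pos_of_mem_bdry ha), fun ha => ?_⟩
    · rintro rfl
      have h1 := hab.2
      rw [region_c_of_notMem_bdry (fun h => h.2.2.1 rfl), h.source_saturated b ih.1 hab.1.1] at h1
      exact lt_irrefl _ h1
    · rw [region_pos_of_mem ha] at hab
      by_cases hb : b ∈ A
      · obtain ⟨u, hu, hbu, hexit⟩ := ih.2.2 hb
        exact ⟨u, hu, hbu.head ⟨ha, hb, hab⟩, hexit⟩
      · refine ⟨a, ha, .refl, ?_⟩
        by_cases hbt : b = N.t
        · exact Or.inl (hbt ▸ hab)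
        · have hbb : b ∈ N.bdry A := ⟨⟨a, ha, hab.1⟩, hb, ih.1, hbt⟩
          exact Or.inr ⟨b, hbb, ih.2.1 hbb, hab⟩

theorem ValidOn.le_of_chain (h : ValidOn N A D d) {u v : V}
    (huv : Relation.ReflTransGen (fun a b => a ∈ A ∧ b ∈ A ∧ N.Pos a b) u v) : d u ≤ d v := by
  induction huv with
  | refl => exact le_rfl
  | tail _ hbc ih => exact ih.trans (h.inner _ hbc.1 _ hbc.2.1 hbc.2.2)

/-- Labels do not decrease along the part of the path inside `A`, and the exit edge lowers them by
at most one, to a value below `k`. -/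
theorem ValidOn.le_of_reaches (h : ValidOn N A D d) {k : ℕ} {z : V} (hz : z ∈ A)
    (hr : (N.region A).Reaches z (target N A d k)) : d z ≤ k := by
  obtain ⟨u, hu, hzu, hexit⟩ := h.exists_exit hz hr
  have h1 := h.le_of_chain hzu
  rcases hexit with hexit | ⟨w, hw, hwk, huw⟩
  · have := h.sink u hu hexit
    omega
  · have := h.outer u hu w hw huw
    omega

theorem ValidOn.region_c_nonneg (h : ValidOn N A D d) {u v : V} (huv : (N.region A).E u v) :
    0 ≤ (N.region A).c u v := by
  simp only [Network.region]
  split_ifs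
  · exact le_rfl
  · exact h.cap_nonneg u v huv.1

end Region

/-! ### Invariants of the stages of ARD, and its output. -/

section Stages

variable {V : Type*} [Fintype V] {N : Network V} {A : Set V} {D : ℕ} {d : V → ℕ}

/-- The invariant of the augmentations in stage `j`. -/
structure StageInv (N : Network V) (A : Set V) (D : ℕ) (d : V → ℕ) (j : ℕ) (f : V → V → ℤ) :
    Prop where
  flow : IsFlow (N.region A) f
  inflow_source : ∑ u, f u N.s = 0
  excess_nonneg : ∀ v ∈ A, 0 ≤ N.e v + ∑ u, f u v
  inflow_nonpos : ∀ v ∈ A, ∑ u, f u v ≤ 0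
  reaches : ∀ k u, ((N.region A).residual f).Reaches u (target N A d k) →
    (N.region A).Reaches u (target N A d k)
  done : ∀ k < j, ∀ v ∈ A, 0 < N.e v + ∑ u, f u v →
    ¬ ((N.region A).residual f).Reaches v (target N A d k)
  origin : ∀ u ∈ N.bdry A, 0 < ∑ w, f w u → d u < D ∧ ∃ x ∈ A, 0 < N.e x ∧
    (N.region A).Reaches x (target N A d D) ∧
    ¬ ((N.region A).residual f).Reaches x (target N A d (d u))

theorem ValidOn.stageInv_zero (h : ValidOn N A D d) : StageInv N A D d 0 (fun _ _ => 0) where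
  flow := ⟨by simp, by simp, fun u v huv => h.region_c_nonneg huv⟩
  inflow_source := by simp
  excess_nonneg := by simpa using h.excess_nonneg
  inflow_nonpos := by simp
  reaches := by
    rintro k u ⟨y, hy, hr⟩
    refine ⟨y, hy, Relation.ReflTransGen.mono (fun a b hab => ⟨hab.1, ?_⟩) _ _ hr⟩
    simpa [Network.residual] using hab.2
  done := by simp
  origin := by simp

theorem StageInv.residual_e {j : ℕ} {f : V → V → ℤ} (hf : StageInv N A D d j f) {v : V}
    (hv : v ∈ A) : ((N.region A).residual f).e v = N.e v + ∑ u, f u v := by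
  rw [hf.flow.residual_e, region_e_of_mem hv]

theorem StageInv.step (h : ValidOn N A D d) {j : ℕ} (hj : j ≤ D) {f f' : V → V → ℤ}
    (hf : StageInv N A D d j f) (hs : AugmentStep (N.region A) A (target N A d j) f f') :
    StageInv N A D d j f' ∧ (∃ x ∈ A, ∑ u, f' u x < ∑ u, f u x) ∧
      ∀ v ∈ A, ∑ u, f' u v ≤ ∑ u, f u v := by
  obtain ⟨x, y, Δ, H⟩ := hs.augmented hf.flow
  have hxA := H.source_mem
  have hyA : y ∉ A := fun h' => h.notMem_target h' j H.target_mem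
  have hxy : x ≠ y := by rintro rfl; exact hyA hxA
  have hys : y ≠ N.s := by
    rintro rfl
    rcases H.target_mem with h' | h'
    · exact N.s_ne_t h'
    · exact h'.1.2.2.1 rfl
  have hxs : x ≠ N.s := by rintro rfl; exact h.source_notMem hxA
  have hΔ := H.pos
  have hle := H.le_excess
  rw [region_e_of_mem hxA] at hle
  have hex : 0 < N.e x + ∑ u, f u x := by omega
  have hanti : ∀ k u, ((N.region A).residual f').Reaches u (target N A d k) →
      ((N.region A).residual f).Reaches u (target N A d k) := by
    -- For `k ≥ j` the target of the augmentation lies in `T_k`; for `k < j` the start `x` has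
    -- excess, so stage `k` has cut it off from `T_k`.
    intro k
    apply H.reaches_anti
    rcases le_or_gt j k with hk | hk
    · exact Or.inl (target_mono hk)
    · exact Or.inr (hf.done k hk x hxA hex)
  have hmono : ∀ v ∈ A, ∑ u, f' u v ≤ ∑ u, f u v := by
    intro v hv
    by_cases hvx : v = x
    · subst hvx; rw [H.inflow_source hxy]; omega
    · exact (H.inflow_other v hvx (by rintro rfl; exact hyA hv)).le
  refine ⟨⟨H.flow, ?_, ?_, ?_, ?_, ?_, ?_⟩, ⟨x, hxA, ?_⟩, hmono⟩
  · rw [H.inflow_other _ (Ne.symm hxs) (Ne.symm hys), hf.inflow_source]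
  · intro v hv
    by_cases hvx : v = x
    · subst hvx; rw [H.inflow_source hxy]; omega
    · rw [H.inflow_other v hvx (by rintro rfl; exact hyA hv)]
      exact hf.excess_nonneg v hv
  · exact fun v hv => (hmono v hv).trans (hf.inflow_nonpos v hv)
  · exact fun k u hu => hf.reaches k u (hanti k u hu)
  · intro k hk v hv he hr
    have := hmono v hv
    exact hf.done k hk v hv (by omega) (hanti k v hr)
  · intro u hu hpos
    by_cases h0 : 0 < ∑ w, f w u
    · obtain ⟨h1, z, hz, hez, hrz, hnz⟩ := hf.origin u hu h0
      exact ⟨h1, z, hz, hez, hrz, fun hc => hnz (hanti _ _ hc)⟩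
    -- This is the first flow into `u`, so the augmentation ends there and `d u < j`. Stage `d u` is
    -- thus over, and `x`, which still had excess, cannot reach `T_{d(u)}`.
    have hux : u ≠ x := by rintro rfl; exact hu.2.1 hxA
    have huy : u = y := by
      by_contra huy
      rw [H.inflow_other u hux huy] at hpos
      exact h0 hpos
    subst huy
    have hdu : d u < j := by
      rcases H.target_mem with h' | h'
      · exact absurd h' hu.2.2.2
      · exact h'.2
    refine ⟨hdu.trans_le hj, x, hxA, ?_, ?_, ?_⟩
    · have := hf.inflow_nonpos x hxA
      omega
    · exact hf.reaches _ _ ⟨u, target_mono hj H.target_mem, H.reaches⟩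
    · exact fun hc => hf.done _ hdu x hxA hex (hanti _ _ hc)
  · rw [H.inflow_source hxy]; omega

/-- The total excess of `A` is a nonnegative integer that drops with each augmentation, since the
paths end outside `A`. -/
theorem StageInv.augmentTerminates (h : ValidOn N A D d) {j : ℕ} (hj : j ≤ D) {f : V → V → ℤ}
    (hf : StageInv N A D d j f) : AugmentTerminates (N.region A) A (target N A d j) f := by
  classical
  obtain ⟨n, hn⟩ : ∃ n : ℕ, (∑ v with v ∈ A, (N.e v + ∑ u, f u v)).toNat = n := ⟨_, rfl⟩
  induction n using Nat.strong_induction_on generalizing f with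
  | _ n ih =>
    refine Acc.intro _ fun f' hs => ?_
    obtain ⟨hf', ⟨x, hx, hlt⟩, hle⟩ := hf.step h hj hs
    refine ih _ ?_ hf' rfl
    have h1 : ∑ v with v ∈ A, (N.e v + ∑ u, f' u v) < ∑ v with v ∈ A, (N.e v + ∑ u, f u v) := by
      refine Finset.sum_lt_sum (fun v hv => ?_) ⟨x, by simpa using hx, by omega⟩
      have := hle v (by simpa using hv)
      omega
    have h2 : 0 ≤ ∑ v with v ∈ A, (N.e v + ∑ u, f' u v) :=
      Finset.sum_nonneg fun v hv => hf'.excess_nonneg v (by simpa using hv)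
    omega

theorem StageInv.next (h : ValidOn N A D d) {j : ℕ} (hj : j ≤ D) {f f' : V → V → ℤ}
    (hf : StageInv N A D d j f) (ha : Augment (N.region A) A (target N A d j) f f') :
    StageInv N A D d (j + 1) f' := by
  obtain ⟨hr, hfinal⟩ := ha
  have hf' : StageInv N A D d j f' := by
    clear hfinal
    induction hr with
    | refl => exact hf
    | tail _ hs ih => exact (ih.step h hj hs).1
  refine { hf' with done := ?_ }
  intro k hk v hv he hreach
  rcases Nat.lt_succ_iff_lt_or_eq.1 hk with hk | rfl
  · exact hf'.done k hk v hv he hreach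
  · exact hfinal (exists_augmentStep hv (by rwa [hf'.residual_e hv]) hreach)

theorem ARDStages.stageInv (h : ValidOn N A D d) {j : ℕ} (hj : j ≤ D + 1) {f : V → V → ℤ}
    (hs : ARDStages N A d j f) : StageInv N A D d j f := by
  induction hs with
  | zero => exact h.stageInv_zero
  | succ _ ha ih => exact (ih (by omega)).next h (by omega) ha

theorem AugmentTerminates.exists_augment {M : Network V} {X Y : Set V} {f : V → V → ℤ}
    (h : AugmentTerminates M X Y f) : ∃ f', Augment M X Y f f' := by
  induction h with
  | intro f _ ih =>
    by_cases hs : ∃ f', AugmentStep M X Y f f'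
    · obtain ⟨f', hs⟩ := hs
      obtain ⟨g, hg, hfinal⟩ := ih f' hs
      exact ⟨g, hg.head hs, hfinal⟩
    · exact ⟨f, .refl, hs⟩

theorem ValidOn.exists_ardStages (h : ValidOn N A D d) (j : ℕ) (hj : j ≤ D + 1) :
    ∃ f, ARDStages N A d j f := by
  induction j with
  | zero => exact ⟨_, .zero⟩
  | succ j ih =>
    obtain ⟨f, hf⟩ := ih (by omega)
    obtain ⟨f', hf'⟩ :=
      ((hf.stageInv h (by omega)).augmentTerminates h (by omega)).exists_augment
    exact ⟨f', hf.succ hf'⟩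

/-- The properties of the output of ARD. -/
structure ARDSpec (N : Network V) (A : Set V) (D : ℕ) (d : V → ℕ) (f : V → V → ℤ) (d' : V → ℕ) :
    Prop where
  flow : IsFlow (N.region A) f
  source : ∀ v, f v N.s = 0
  excess_nonneg : ∀ v ∈ A, 0 ≤ N.e v + ∑ u, f u v
  of_excess_pos : ∀ v ∈ A, 0 < N.e v + ∑ u, f u v →
    d' v = D ∧ ¬ ((N.region A).residual f).Reaches v (target N A d D)
  le : ∀ v ∈ A, d v ≤ d' v
  le_max : ∀ v ∈ A, d' v ≤ D
  inner : ∀ u ∈ A, ∀ v ∈ A, ((N.region A).residual f).Pos u v → d' u ≤ d' v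
  outer : ∀ u ∈ A, ∀ v ∈ N.bdry A, ((N.region A).residual f).Pos u v → d' u ≤ d v + 1
  back : ∀ u ∈ N.bdry A, ∀ v ∈ A, ((N.region A).residual f).Pos u v → d u ≤ d' v
  sink : ∀ u ∈ A, ((N.region A).residual f).Pos u N.t → d' u = 0
  nonneg : ∀ u ∈ N.bdry A, ∀ w, 0 ≤ f w u
  origin : ∀ u ∈ N.bdry A, ∀ w, 0 < f w u → d u < D ∧ ∃ x ∈ A, 0 < N.e x ∧
    (N.region A).Reaches x (target N A d D) ∧ d u < d' x

/-- Covers both branches of the relabeling at once, so that every inequality between labels becomes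
a statement about reachability. -/
theorem lt_regionRelabel_iff {f : V → V → ℤ} {u : V} (hu : u ∈ A) {k : ℕ} :
    k < regionRelabel N A D d f u ↔
      k < D ∧ ¬ ((N.region A).residual f).Reaches u (target N A d k) := by
  simp only [regionRelabel, if_pos hu]
  split_ifs with h
  · set S := {k | ((N.region A).residual f).Reaches u (target N A d k)} with hS
    have hD : D ∈ S := h
    constructor
    · intro hk
      exact ⟨hk.trans_le (Nat.sInf_le hD), fun hc => absurd (Nat.sInf_le (s := S) hc) (by omega)⟩
    · rintro ⟨-, hk⟩
      by_contra hc
      exact hk ((Nat.sInf_mem ⟨D, hD⟩ : sInf S ∈ S).mono (target_mono (not_lt.1 hc)))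
  · exact ⟨fun hk => ⟨hk, fun hc => h (hc.mono (target_mono hk.le))⟩, fun hk => hk.1⟩

theorem ARD.spec (h : ValidOn N A D d) {f : V → V → ℤ} {d' : V → ℕ} (ha : ARD N A D d f d') :
    ARDSpec N A D d f d' := by
  obtain ⟨hs, rfl⟩ := ha
  have hf := hs.stageInv h le_rfl
  have hnonneg : ∀ u ∈ N.bdry A, ∀ w, 0 ≤ f w u := by
    intro u hu w
    by_cases hE : (N.region A).E u w
    · have h1 := hf.flow.capacity u w hE
      rw [region_c_of_mem_bdry hu (mem_of_region_E hu hE), hf.flow.antisymm] at h1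
      omega
    · rw [hf.flow.antisymm, hf.flow.support u w hE]; simp
  have hsource : ∀ w, 0 ≤ f w N.s := by
    intro w
    by_cases hw : w = N.s
    · subst hw
      have := hf.flow.antisymm N.s N.s
      omega
    by_cases hE : (N.region A).E N.s w
    · have h1 := hf.flow.capacity N.s w hE
      rw [region_c_of_notMem_bdry (fun h => h.2.2.1 rfl), h.source_saturated w hw hE.1,
        hf.flow.antisymm] at h1
      omega
    · rw [hf.flow.antisymm, hf.flow.support _ w hE]; simp
  have hle : ∀ v ∈ A, regionRelabel N A D d f v ≤ D := by
    intro v hv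
    by_contra hc
    exact lt_irrefl _ ((lt_regionRelabel_iff hv).1 (not_le.1 hc)).1
  have hstep : ∀ u v k, ((N.region A).residual f).Pos u v →
      ((N.region A).residual f).Reaches v (target N A d k) →
      ((N.region A).residual f).Reaches u (target N A d k) := fun u v k h1 h2 => h2.head h1
  refine ⟨hf.flow, ?_, hf.excess_nonneg, ?_, ?_, hle, ?_, ?_, ?_, ?_, hnonneg, ?_⟩
  · intro v
    -- Saturation makes all flow into the source nonnegative, and its total is zero.
    exact (Finset.sum_eq_zero_iff_of_nonneg fun w _ => hsource w).1 hf.inflow_source v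
      (Finset.mem_univ v)
  · intro v hv he
    have h1 := hf.done D (Nat.lt_succ_self D) v hv he
    exact ⟨by simp only [regionRelabel, if_pos hv, if_neg h1], h1⟩
  · intro v hv
    by_contra hc
    have hlt := not_le.1 hc
    have hvD := h.le_max v (by rintro rfl; exact h.source_notMem hv)
      (by rintro rfl; exact h.sink_notMem hv)
    have h1 := mt (fun h1 => (lt_regionRelabel_iff hv).2 ⟨hlt.trans_le hvD, h1⟩) (lt_irrefl _)
    rw [not_not] at h1
    exact hc (h.le_of_reaches hv (hf.reaches _ _ h1))
  · intro u hu v hv huv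
    by_contra hc
    obtain ⟨h1, h2⟩ := (lt_regionRelabel_iff hu).1 (not_le.1 hc)
    have h3 := mt (fun h3 => (lt_regionRelabel_iff hv).2 ⟨h1, h3⟩) (lt_irrefl _)
    exact h2 (hstep u v _ huv (not_not.1 h3))
  · intro u hu v hv huv
    by_contra hc
    obtain ⟨h1, h2⟩ := (lt_regionRelabel_iff hu).1 (not_le.1 hc)
    exact h2 (hstep u v _ huv (Network.reaches_of_mem (Or.inr ⟨hv, Nat.lt_succ_self _⟩)))
  · intro u hu v hv huv
    by_contra hc
    have huD := h.le_max u hu.2.2.1 hu.2.2.2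
    have h3 := mt (fun h3 => (lt_regionRelabel_iff hv).2 ⟨(not_le.1 hc).trans_le huD, h3⟩)
      (lt_irrefl _)
    -- Residual reachability gives reachability in the original region network, where `u` has no
    -- outgoing edge of positive capacity; so `u` itself is a target.
    have := mem_target_of_region_reaches hu (hf.reaches _ _ (hstep u v _ huv (not_not.1 h3)))
    omega
  · intro u hu huv
    by_contra hc
    obtain ⟨h1, h2⟩ := (lt_regionRelabel_iff hu).1 (Nat.pos_of_ne_zero hc)
    exact h2 (hstep u _ _ huv (Network.reaches_of_mem (Or.inl rfl)))
  · intro u hu w hw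
    obtain ⟨h1, x, hx, hex, hrx, hnx⟩ := hf.origin u hu
      (hw.trans_le (Finset.single_le_sum (fun w _ => hnonneg u hu w) (Finset.mem_univ w)))
    exact ⟨h1, x, hx, hex, hrx, (lt_regionRelabel_iff hx).2 ⟨h1, hnx⟩⟩

end Stages

end PARD

namespace PARD

/-! ### Fusing the flows and labels of the regions. -/

section Fusion

variable {V : Type*} {N : Network V} {K : ℕ} {R : Fin K → Set V} {D : ℕ} {d : V → ℕ}

theorem mem_bdry_of_ne (hR : IsRegionPartition N R) {j k : Fin K} (hjk : j ≠ k) {u v : V}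
    (hu : u ∈ R k) (hv : v ∈ R j) (h : N.E u v) : v ∈ N.bdry (R k) :=
  ⟨⟨u, hu, h⟩, fun hvk => Set.disjoint_left.1 (hR.1 j k hjk) hv hvk, (hR.2 v).1 ⟨j, hv⟩⟩

theorem exists_mem_of_mem_bdry (hR : IsRegionPartition N R) {k : Fin K} {v : V}
    (hv : v ∈ N.bdry (R k)) : ∃ j, j ≠ k ∧ v ∈ R j := by
  obtain ⟨j, hj⟩ := (hR.2 v).2 hv.2.2
  exact ⟨j, by rintro rfl; exact hv.2.1 hj, hj⟩

theorem mem_boundary {k : Fin K} {v : V} (h : v ∈ N.bdry (R k)) : v ∈ boundary N R :=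
  Set.mem_iUnion.2 ⟨k, h⟩

theorem ne_of_mem_boundary {v : V} (h : v ∈ boundary N R) : v ≠ N.s ∧ v ≠ N.t := by
  obtain ⟨k, hk⟩ := Set.mem_iUnion.1 h
  exact hk.2.2

variable [Fintype V]

/-- The outputs of ARD on all regions, and their fusion. -/
structure Fusion (N : Network V) (R : Fin K → Set V) (D : ℕ) (d : V → ℕ) (fk : Fin K → V → V → ℤ)
    (dk : Fin K → V → ℕ) (f' : V → V → ℤ) (d' : V → ℕ) : Prop where
  part : IsRegionPartition N R
  valid : ∀ k, ValidOn N (R k) D d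
  spec : ∀ k, ARDSpec N (R k) D d (fk k) (dk k)
  labels : FusedLabels R d dk d'
  flow : FusedFlow N R d' fk f'

namespace Fusion

variable {fk : Fin K → V → V → ℤ} {dk : Fin K → V → ℕ} {f' : V → V → ℤ} {d' : V → ℕ}

theorem le (H : Fusion N R D d fk dk f' d') {v : V} (hs : v ≠ N.s) (ht : v ≠ N.t) :
    d v ≤ d' v := by
  obtain ⟨k, hk⟩ := (H.part.2 v).2 ⟨hs, ht⟩
  rw [H.labels.1 k v hk]
  exact (H.spec k).le v hk

theorem le_max (H : Fusion N R D d fk dk f' d') {v : V} (hs : v ≠ N.s) (ht : v ≠ N.t) :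
    d' v ≤ D := by
  obtain ⟨k, hk⟩ := (H.part.2 v).2 ⟨hs, ht⟩
  rw [H.labels.1 k v hk]
  exact (H.spec k).le_max v hk

theorem eq_zero (H : Fusion N R D d fk dk f' d') (k : Fin K) {u v : V} (h : ¬ N.E u v) :
    fk k u v = 0 := (H.spec k).flow.support u v fun h' => h h'.1

theorem nonneg (H : Fusion N R D d fk dk f' d') {j k : Fin K} (hjk : j ≠ k) {u v : V}
    (hu : u ∈ R j) (hv : v ∈ R k) : 0 ≤ fk j u v := by
  by_cases h : N.E u v
  · exact (H.spec j).nonneg v (mem_bdry_of_ne H.part hjk.symm hu hv h) u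
  · rw [H.eq_zero j h]

theorem nonpos (H : Fusion N R D d fk dk f' d') {j k : Fin K} (hjk : j ≠ k) {u v : V}
    (hu : u ∈ R k) (hv : v ∈ R j) : fk j u v ≤ 0 := by
  have := H.nonneg hjk hv hu
  rw [(H.spec j).flow.antisymm]
  omega

theorem flow_eq (H : Fusion N R D d fk dk f' d') {k : Fin K} {u v : V} (hv : v ∈ R k)
    (hu : u ∈ R k ∨ u = N.s ∨ u = N.t) : f' u v = fk k u v ∧ f' v u = fk k v u := by
  rcases hu with hu | hu
  · exact ⟨H.flow.2.1 k u hu v hv, H.flow.2.1 k v hv u hu⟩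
  · exact (H.flow.2.2.1 k v hv u hu).symm

theorem flow_support (H : Fusion N R D d fk dk f' d') {u v : V} (h : ¬ N.E u v) : f' u v = 0 := by
  by_cases hu : u = N.s ∨ u = N.t
  · by_cases hv : v = N.s ∨ v = N.t
    · exact H.flow.2.2.2 u v hu hv
    · obtain ⟨k, hk⟩ := (H.part.2 v).2 (not_or.1 hv)
      rw [(H.flow_eq hk (Or.inr hu)).1, H.eq_zero k h]
  · obtain ⟨j, hj⟩ := (H.part.2 u).2 (not_or.1 hu)
    by_cases hv : v = N.s ∨ v = N.t
    · rw [(H.flow_eq hj (Or.inr hv)).2, H.eq_zero j h]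
    · obtain ⟨k, hk⟩ := (H.part.2 v).2 (not_or.1 hv)
      by_cases hjk : j = k
      · subst hjk
        rw [(H.flow_eq hj (Or.inl hk)).2, H.eq_zero j h]
      · rw [H.flow.1 j k hjk u hj v hk, H.eq_zero j h, H.eq_zero k h]; simp

theorem residual_e (H : Fusion N R D d fk dk f' d') (v : V) :
    (N.residual f').e v = N.e v + ∑ u, f' u v := by
  simp only [Network.residual]
  congr 1
  apply Finset.sum_subset (Finset.subset_univ _)
  intro u _ hu
  exact H.flow_support (by simpa using hu)

/-- The fused flow brings to a region vertex at least as much as the flow of its region; the surplus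
comes from a neighbouring region or from a cancelled flow. -/
theorem le_flow (H : Fusion N R D d fk dk f' d') {k : Fin K} {v : V} (hv : v ∈ R k) (u : V) :
    fk k u v ≤ f' u v ∧ (fk k u v < f' u v → ∃ j, j ≠ k ∧ u ∈ R j ∧ N.E u v ∧
      (0 < fk j u v ∨ (0 < fk k v u ∧ d' v + 1 < d' u))) := by
  by_cases hu : u = N.s ∨ u = N.t
  · rw [(H.flow_eq hv (Or.inr hu)).1]; simp
  obtain ⟨j, hj⟩ := (H.part.2 u).2 (not_or.1 hu)
  by_cases hjk : j = k
  · subst hjk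
    rw [(H.flow_eq hv (Or.inl hj)).1]; simp
  have h1 := H.nonneg hjk hj hv
  have h2 := H.nonpos (Ne.symm hjk) hj hv
  have h3 := (H.spec k).flow.antisymm v u
  have h4 : f' u v = _ := H.flow.1 j k hjk u hj v hv
  have hE : fk k u v < f' u v → N.E u v := by
    intro h
    by_contra hE
    rw [H.flow_support hE, H.eq_zero k hE] at h
    exact lt_irrefl _ h
  simp only [validPair] at h4
  constructor
  · split_ifs at h4 <;> omega
  · intro h
    refine ⟨j, hjk, hj, hE h, ?_⟩
    split_ifs at h4 <;> omega

theorem excess_le (H : Fusion N R D d fk dk f' d') {k : Fin K} {v : V} (hv : v ∈ R k) :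
    N.e v + ∑ u, fk k u v ≤ (N.residual f').e v := by
  rw [H.residual_e]
  have := Finset.sum_le_sum fun u (_ : u ∈ Finset.univ) => (H.le_flow hv u).1
  omega

theorem exists_of_excess_pos (H : Fusion N R D d fk dk f' d') {k : Fin K} {v : V} (hv : v ∈ R k)
    (he : 0 < (N.residual f').e v) : 0 < N.e v + ∑ u, fk k u v ∨
      ∃ u j, j ≠ k ∧ u ∈ R j ∧ N.E u v ∧ (0 < fk j u v ∨ (0 < fk k v u ∧ d' v + 1 < d' u)) := by
  by_cases h0 : 0 < N.e v + ∑ u, fk k u v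
  · exact Or.inl h0
  right
  rw [H.residual_e] at he
  obtain ⟨u, -, hu⟩ := Finset.exists_lt_of_sum_lt
    (show ∑ u, fk k u v < ∑ u, f' u v by omega)
  exact ⟨u, (H.le_flow hv u).2 hu⟩

theorem pos_iff (H : Fusion N R D d fk dk f' d') {k : Fin K} {u v : V} (hu : u ∈ R k)
    (hv : v ∈ R k ∨ v = N.s ∨ v = N.t) :
    (N.residual f').Pos u v ↔ ((N.region (R k)).residual (fk k)).Pos u v := by
  have h1 := (H.flow_eq hu hv).2
  have h2 := region_c_of_mem (N := N) (v := v) hu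
  have h3 := region_E_of_mem_left (N := N) (v := v) hu
  simp only [Network.Pos, Network.residual, h1, h2, h3]

theorem flow_le_cap (H : Fusion N R D d fk dk f' d') (k₀ : Fin K) {u v : V} (hE : N.E u v) :
    f' u v ≤ N.c u v := by
  have hcap : ∀ k, u ∈ R k → fk k u v ≤ N.c u v := by
    intro k hk
    have := (H.spec k).flow.capacity u v ((region_E_of_mem_left hk).2 hE)
    rwa [region_c_of_mem hk] at this
  by_cases hu : u = N.s ∨ u = N.t
  · by_cases hv : v = N.s ∨ v = N.t
    · rw [H.flow.2.2.2 u v hu hv]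
      exact (H.valid k₀).cap_nonneg u v hE
    · obtain ⟨k, hk⟩ := (H.part.2 v).2 (not_or.1 hv)
      rw [(H.flow_eq hk (Or.inr hu)).1]
      have := (H.spec k).flow.capacity u v ((region_E_of_mem hk).2 hE)
      rwa [region_c_of_notMem_bdry (fun h => hu.elim h.2.2.1 h.2.2.2)] at this
  · obtain ⟨j, hj⟩ := (H.part.2 u).2 (not_or.1 hu)
    by_cases hv : v = N.s ∨ v = N.t
    · rw [(H.flow_eq hj (Or.inr hv)).2]
      exact hcap j hj
    · obtain ⟨k, hk⟩ := (H.part.2 v).2 (not_or.1 hv)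
      by_cases hjk : j = k
      · subst hjk
        rw [(H.flow_eq hj (Or.inl hk)).2]
        exact hcap j hj
      · have h1 := H.nonpos (Ne.symm hjk) hj hk
        have h2 := hcap j hj
        have h3 := (H.valid j).cap_nonneg u v hE
        have h4 : f' u v = _ := H.flow.1 j k hjk u hj v hk
        -- The two contributions have opposite signs, so the neighbour's can only lower the flow
        -- from `u` to `v`.
        simp only [validPair] at h4
        split_ifs at h4 <;> omega

theorem validOn (H : Fusion N R D d fk dk f' d') (k : Fin K) :
    ValidOn (N.residual f') (R k) D d' where
  source_notMem := (H.valid k).source_notMem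
  sink_notMem := (H.valid k).sink_notMem
  cap_nonneg u v hE := sub_nonneg.2 (H.flow_le_cap k hE)
  excess_nonneg v hv := ((H.spec k).excess_nonneg v hv).trans (H.excess_le hv)
  source_saturated v hv hE := by
    have hE' : N.E N.s v := hE
    have h1 : N.c N.s v = 0 := (H.valid k).source_saturated v hv hE'
    have h2 : f' N.s v = 0 := by
      by_cases ht : v = N.t
      · exact H.flow.2.2.2 _ _ (Or.inl rfl) (Or.inr ht)
      · obtain ⟨j, hj⟩ := (H.part.2 v).2 ⟨hv, ht⟩
        rw [(H.flow_eq hj (Or.inr (Or.inl rfl))).1, (H.spec j).flow.antisymm, (H.spec j).source v,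
          neg_zero]
    change N.c N.s v - f' N.s v = 0
    rw [h1, h2, sub_zero]
  le_max v hs ht := H.le_max hs ht
  inner u hu v hv huv := by
    rw [H.labels.1 k u hu, H.labels.1 k v hv]
    exact (H.spec k).inner u hu v hv ((H.pos_iff hu (Or.inl hv)).1 huv)
  outer u hu v hv huv := by
    have hv' : v ∈ N.bdry (R k) := hv
    obtain ⟨j, hjk, hj⟩ := exists_mem_of_mem_bdry H.part hv'
    by_contra hc
    -- If the pair violated validity, `α(u,v) = 0` would discard the neighbour's flow. The edge then
    -- has the residual capacity it has in the network of `R k`, where ARD guarantees validity even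
    -- against the old, smaller label of `v`.
    have h1 : f' u v = _ := H.flow.1 k j (Ne.symm hjk) u hu v hj
    rw [validPair, validPair, if_pos (by omega), if_neg hc, one_mul, zero_mul, add_zero] at h1
    have h2 : ((N.region (R k)).residual (fk k)).Pos u v := by
      refine ⟨(region_E_of_mem_left hu).2 huv.1, ?_⟩
      have h3 : 0 < N.c u v - f' u v := huv.2
      change 0 < (N.region (R k)).c u v - fk k u v
      rwa [region_c_of_mem hu, ← h1]
    have h3 := (H.spec k).outer u hu v hv' h2
    have h4 := H.le hv'.2.2.1 hv'.2.2.2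
    rw [← H.labels.1 k u hu] at h3
    omega
  sink u hu huv := by
    rw [H.labels.1 k u hu]
    exact (H.spec k).sink u hu ((H.pos_iff hu (Or.inr (Or.inr rfl))).1 huv)

end Fusion

end Fusion

/-! ### The global gap heuristic preserves validity. -/

section Gap

variable {V : Type*} {N : Network V} {A : Set V} {D : ℕ} {d d' : V → ℕ}

theorem GlobalGap.eq_of_lt (h : GlobalGap D d d') {v : V} (hv : d' v < D) : d' v = d v := by
  rcases h with rfl | ⟨g, -, -, rfl⟩
  · rfl
  · simp only at hv ⊢
    split_ifs at hv ⊢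
    · omega
    · rfl

theorem GlobalGap.le (h : GlobalGap D d d') {v : V} (hv : d v ≤ D) : d v ≤ d' v ∧ d' v ≤ D := by
  rcases h with rfl | ⟨g, -, -, rfl⟩
  · exact ⟨le_rfl, hv⟩
  · simp only
    split_ifs
    · exact ⟨hv, le_rfl⟩
    · exact ⟨le_rfl, hv⟩

/-- The danger is `d v ≤ g < d u`. As the value `g` is not taken, this would mean `d v < g < d u`, a
jump of at least two. -/
theorem GlobalGap.le_add (h : GlobalGap D d d') {u v : V} {m : ℕ} (hm : m ≤ 1) (hu : d u ≤ D)
    (huv : d u ≤ d v + m) : d' u ≤ d' v + m := by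
  rcases h with rfl | ⟨g, -, hg, rfl⟩
  · exact huv
  · have := hg v
    simp only
    split_ifs <;> omega

theorem ValidOn.globalGap (h : ValidOn N A D d) (hg : GlobalGap D d d') : ValidOn N A D d' where
  source_notMem := h.source_notMem
  sink_notMem := h.sink_notMem
  cap_nonneg := h.cap_nonneg
  excess_nonneg := h.excess_nonneg
  source_saturated := h.source_saturated
  le_max v hs ht := (hg.le (h.le_max v hs ht)).2
  inner u hu v hv huv := hg.le_add (m := 0) (by omega)
    (h.le_max u (by rintro rfl; exact h.source_notMem hu) (by rintro rfl; exact h.sink_notMem hu))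
    (h.inner u hu v hv huv)
  outer u hu v hv huv := hg.le_add (m := 1) le_rfl
    (h.le_max u (by rintro rfl; exact h.source_notMem hu) (by rintro rfl; exact h.sink_notMem hu))
    (h.outer u hu v hv huv)
  sink u hu huv := by
    have h0 := h.sink u hu huv
    rcases hg with rfl | ⟨g, h1, -, rfl⟩
    · exact h0
    · simp [h0]

end Gap

end PARD

namespace PARD

/-! ### The potential: boundary label sum against labels of eligible vertices. -/

section Potential

variable {V : Type*} [Fintype V] {N : Network V} {K : ℕ} {R : Fin K → Set V} {D : ℕ} {d d' : V → ℕ}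

open Classical in
/-- The sum of the labels of the boundary vertices. -/
noncomputable def labelSum (N : Network V) (R : Fin K → Set V) (d : V → ℕ) : ℕ :=
  ∑ v with v ∈ boundary N R, d v

/-- The label sum rises at least as much as its part over `s`; written additively to avoid
subtraction in `ℕ`. -/
theorem labelSum_add_sum_le (h : ∀ v ∈ boundary N R, d v ≤ d' v) {s : Finset V}
    (hs : ∀ v ∈ s, v ∈ boundary N R) :
    labelSum N R d + ∑ v ∈ s, d' v ≤ labelSum N R d' + ∑ v ∈ s, d v := by
  classical
  have hsub : s ⊆ Finset.univ.filter (· ∈ boundary N R) := fun v hv => by simpa using hs v hv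
  have h1 := Finset.sum_sdiff (f := d) hsub
  have h2 := Finset.sum_sdiff (f := d') hsub
  have h3 : ∑ v ∈ (Finset.univ.filter (· ∈ boundary N R)) \ s, d v ≤
      ∑ v ∈ (Finset.univ.filter (· ∈ boundary N R)) \ s, d' v :=
    Finset.sum_le_sum fun v hv => h v (by simpa using (Finset.mem_sdiff.1 hv).1)
  unfold labelSum
  omega

theorem labelSum_lt {v : V} (hv : v ∈ boundary N R) (hvD : d v < dInf N R)
    (h : ∀ v ∈ boundary N R, d v ≤ dInf N R) : labelSum N R d < dInf N R ^ 2 := by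
  classical
  have h1 : labelSum N R d < ∑ v with v ∈ boundary N R, dInf N R :=
    Finset.sum_lt_sum (fun w hw => h w (by simpa using hw)) ⟨v, by simpa using hv, hvD⟩
  rw [Finset.sum_const, smul_eq_mul] at h1
  have h2 : (Finset.univ.filter (· ∈ boundary N R)).card = dInf N R := by
    rw [dInf, ← Set.ncard_coe_finset, Finset.coe_filter_univ, Set.ofPred_mem_eq]
  rw [h2] at h1
  nlinarith

/-- `x` has positive excess, and is active or can send flow in its region network. -/
def Eligible (N : Network V) (R : Fin K → Set V) (D : ℕ) (d : V → ℕ) (x : V) : Prop :=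
  ∃ k, x ∈ R k ∧ 0 < N.e x ∧
    (d x < D ∨ (N.region (R k)).Reaches x (target N (R k) d D))

namespace Fusion

variable {fk : Fin K → V → V → ℤ} {dk : Fin K → V → ℕ} {f' : V → V → ℤ} {d'' : V → ℕ}

theorem mem_boundary_of_active (H : Fusion N R D d fk dk f' d') {v : V} (hs : v ≠ N.s)
    (ht : v ≠ N.t) (he : 0 < (N.residual f').e v) (hd : d' v < D) : v ∈ boundary N R := by
  obtain ⟨k, hk⟩ := (H.part.2 v).2 ⟨hs, ht⟩
  rcases H.exists_of_excess_pos hk he with h | ⟨u, j, hjk, hj, hE, -⟩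
  · have := ((H.spec k).of_excess_pos v hk h).1
    rw [← H.labels.1 k v hk] at this
    omega
  · exact mem_boundary (mem_bdry_of_ne H.part hjk.symm hj hk hE)

theorem exists_eligible (H : Fusion N R D d fk dk f' d')
    (hact : ∀ x, x ≠ N.s → x ≠ N.t → 0 < N.e x → d x < D → x ∈ boundary N R)
    {j : Fin K} {w u : V} (hu : u ∈ N.bdry (R j)) (hw : 0 < fk j w u) :
    d u < D ∧ ∃ x ∈ R j, Eligible N R D d x ∧ d u < d' x ∧ (x ∈ boundary N R ∨ d x = D) := by
  obtain ⟨h1, x, hx, hex, hrx, hux⟩ := (H.spec j).origin u hu w hw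
  rw [← H.labels.1 j x hx] at hux
  refine ⟨h1, x, hx, ⟨j, hx, hex, Or.inr hrx⟩, hux, ?_⟩
  obtain ⟨hs, ht⟩ := (H.part.2 x).1 ⟨j, hx⟩
  rcases ((H.valid j).le_max x hs ht).lt_or_eq with h | h
  · exact Or.inl (hact x hs ht hex h)
  · exact Or.inr h

theorem boundary_le (H : Fusion N R D d fk dk f' d') (hg : GlobalGap D d' d'') {v : V}
    (hv : v ≠ N.s ∧ v ≠ N.t) : d v ≤ d' v ∧ d' v ≤ d'' v ∧ d'' v ≤ D :=
  ⟨H.le hv.1 hv.2, hg.le (H.le_max hv.1 hv.2)⟩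

/-- If the origin `x` is in `𝓑`, the rises at `u` and `x` suffice, as the new label of `x` exceeds
`d u`. If `d x = D`, the rise at `u` alone suffices, as `d u < D`. -/
theorem eligible_of_inflow (H : Fusion N R D d fk dk f' d') (hg : GlobalGap D d' d'')
    (hact : ∀ x, x ≠ N.s → x ≠ N.t → 0 < N.e x → d x < D → x ∈ boundary N R)
    {j : Fin K} {w u : V} (hu : u ∈ N.bdry (R j)) (hw : 0 < fk j w u) :
    ∃ x, Eligible N R D d x ∧ d'' u + 1 + labelSum N R d ≤ d x + labelSum N R d'' := by
  classical
  have hmono : ∀ v ∈ boundary N R, d v ≤ d'' v := fun v hv =>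
    have := H.boundary_le hg (ne_of_mem_boundary hv)
    this.1.trans this.2.1
  obtain ⟨huD, x, hx, hel, hux, hxB⟩ := H.exists_eligible hact hu hw
  refine ⟨x, hel, ?_⟩
  have huB := mem_boundary (R := R) hu
  have h1 := H.boundary_le hg hu.2.2
  have h2 := H.boundary_le hg ((H.part.2 x).1 ⟨j, hx⟩)
  rcases hxB with hxB | hxD
  · have hne : u ≠ x := by rintro rfl; exact hu.2.1 hx
    have h3 := labelSum_add_sum_le hmono (s := {u, x}) (by simp [huB, hxB])
    simp only [Finset.sum_pair hne] at h3
    omega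
  · have h3 := labelSum_add_sum_le hmono (s := {u}) (by simp [huB])
    simp only [Finset.sum_singleton] at h3
    omega

/-- Flow from `v` to `u` is cancelled only if `u` is relabeled above `d' v + 1`. The reverse
residual edge in the region network gives `d u ≤ d' v`, so `u` rises by at least two. -/
theorem eligible_of_cancel (H : Fusion N R D d fk dk f' d') (hg : GlobalGap D d' d'')
    (hact : ∀ x, x ≠ N.s → x ≠ N.t → 0 < N.e x → d x < D → x ∈ boundary N R)
    {k : Fin K} {v u : V} (hv : v ∈ R k) (hu : u ∈ N.bdry (R k)) (hvB : v ∈ boundary N R)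
    (hw : 0 < fk k v u) (hd : d' v + 1 < d' u) :
    ∃ x, Eligible N R D d x ∧ d'' v + 1 + labelSum N R d ≤ d x + labelSum N R d'' := by
  classical
  have hmono : ∀ v ∈ boundary N R, d v ≤ d'' v := fun v hv =>
    have := H.boundary_le hg (ne_of_mem_boundary hv)
    this.1.trans this.2.1
  obtain ⟨huD, x, hx, hel, hux, hxB⟩ := H.exists_eligible hact hu hw
  refine ⟨x, hel, ?_⟩
  have huB := mem_boundary (R := R) hu
  have h1 := H.boundary_le hg hu.2.2
  have h2 := H.boundary_le hg ((H.part.2 x).1 ⟨k, hx⟩)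
  have h3 := H.boundary_le hg ((H.part.2 v).1 ⟨k, hv⟩)
  have hE : (N.region (R k)).E v u := by
    by_contra hE
    rw [(H.spec k).flow.support v u hE] at hw
    exact lt_irrefl _ hw
  have hvu : d v ≤ d u + 1 := by
    refine (H.valid k).outer v hv u hu ⟨hE.1, ?_⟩
    have := (H.spec k).flow.capacity v u hE
    rw [region_c_of_mem hv] at this
    omega
  have huv : d u ≤ d' v := by
    rw [H.labels.1 k v hv]
    refine (H.spec k).back u hu v hv ⟨(N.region (R k)).symm _ _ hE, ?_⟩
    have := (H.spec k).flow.antisymm v u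
    change 0 < (N.region (R k)).c u v - fk k u v
    rw [region_c_of_mem_bdry hu hv]
    omega
  have huv' : u ≠ v := by rintro rfl; exact hu.2.1 hv
  have hux' : u ≠ x := by rintro rfl; exact hu.2.1 hx
  rcases hxB with hxB | hxD
  · by_cases hvx : v = x
    · subst hvx
      have h4 := labelSum_add_sum_le hmono (s := {u, v}) (by simp [huB, hvB])
      simp only [Finset.sum_pair huv'] at h4
      omega
    · have h4 := labelSum_add_sum_le hmono (s := {u, v, x}) (by simp [huB, hvB, hxB])
      have hnot : u ∉ ({v, x} : Finset V) := by simp [huv', hux']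
      rw [Finset.sum_insert hnot, Finset.sum_insert hnot, Finset.sum_pair hvx,
        Finset.sum_pair hvx] at h4
      omega
  · have h4 := labelSum_add_sum_le hmono (s := {u}) (by simp [huB])
    simp only [Finset.sum_singleton] at h4
    omega

/-- The maximal label of the eligible vertices increases in a sweep by less than the sum of the labels
of the boundary vertices does. -/
theorem eligible_step (H : Fusion N R D d fk dk f' d') (hg : GlobalGap D d' d'') (hD : 0 < D)
    (hact : ∀ x, x ≠ N.s → x ≠ N.t → 0 < N.e x → d x < D → x ∈ boundary N R)
    {v : V} (hv : Eligible (N.residual f') R D d'' v) :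
    ∃ x, Eligible N R D d x ∧ d'' v + 1 + labelSum N R d ≤ d x + labelSum N R d'' := by
  obtain ⟨k, hk, he, hlive⟩ := hv
  have hvl := H.boundary_le hg ((H.part.2 v).1 ⟨k, hk⟩)
  rcases H.exists_of_excess_pos hk he with h | ⟨u, j, hjk, hj, hE, h | ⟨h, hd⟩⟩
  -- Here ARD left `v` cut off from `T_D`, with label `D`, so eligibility means that fusion reopened
  -- a path. Fusion leaves edges inside `R k` as ARD left them; hence the exit edge from `u` to `w`
  -- was saturated by `fk k` and reopened by a neighbour's flow into `u`, whose new label is at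
  -- least that of `v`.
  · obtain ⟨h1, h2⟩ := (H.spec k).of_excess_pos v hk h
    rw [← H.labels.1 k v hk] at h1
    have hvD : d'' v = D := by omega
    have hlive := hlive.resolve_left (by omega)
    have hval := H.validOn k
    have hval' := hval.globalGap hg
    obtain ⟨u, hu, hvu, hexit⟩ := hval'.exists_exit hk hlive
    have h3 := hval.le_of_chain hvu
    have h4 := hval'.le_of_chain hvu
    rcases hexit with hexit | ⟨w, hw, hwD, huw⟩
    · have := hval'.sink u hu hexit
      omega
    · have hw' : w ∈ N.bdry (R k) := hw
      have h5 := hval'.outer u hu w hw huw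
      have h6 := hg.eq_of_lt hwD
      have hwl := H.boundary_le hg hw'.2.2
      have hul := H.boundary_le hg ((H.part.2 u).1 ⟨k, hu⟩)
      obtain ⟨j, hjk, hj⟩ := exists_mem_of_mem_bdry H.part hw'
      have h7 : f' u w = _ := H.flow.1 k j (Ne.symm hjk) u hu w hj
      -- Both flows are kept: `d' u = D`, and validity with `d'' w < D` forces `d' w = D - 1`.
      rw [validPair, validPair, if_pos (by omega), if_pos (by omega), one_mul, one_mul] at h7
      have h8 : 0 < N.c u w - f' u w := huw.2
      have hE : N.E u w := huw.1
      have h9 : N.c u w ≤ fk k u w := by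
        by_contra hc
        have hpos : ((N.region (R k)).residual (fk k)).Pos u w := by
          refine ⟨(region_E_of_mem_left hu).2 hE, ?_⟩
          change 0 < (N.region (R k)).c u w - fk k u w
          rw [region_c_of_mem hu]
          omega
        have hchain := Relation.ReflTransGen.mono (fun a b hab =>
          (H.pos_iff hab.1 (Or.inl hab.2.1)).1 hab.2.2) _ _ hvu
        exact h2 (.trans hchain (.head hpos
          (Network.reaches_of_mem (Or.inr ⟨hw', by omega⟩))))
      have h10 := (H.spec j).flow.antisymm u w
      have huB : u ∈ N.bdry (R j) := mem_bdry_of_ne H.part hjk.symm hj hu (N.symm _ _ hE)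
      obtain ⟨x, hx, hxl⟩ := H.eligible_of_inflow hg hact huB (show 0 < fk j w u by omega)
      exact ⟨x, hx, by omega⟩
  · exact H.eligible_of_inflow hg hact (mem_bdry_of_ne H.part hjk.symm hj hk hE) h
  · exact H.eligible_of_cancel hg hact hk (mem_bdry_of_ne H.part hjk hk hj (N.symm _ _ hE))
      (mem_boundary (mem_bdry_of_ne H.part hjk.symm hj hk hE)) h hd

end Fusion

end Potential

/-! ### The main loop and the count of sweeps. -/

section Algorithm

variable {V : Type*} {K : ℕ} {R : Fin K → Set V}

/-- The invariant of the main loop. -/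
structure LoopInv (R : Fin K → Set V) (B : Set V) (S : AlgState V) : Prop where
  part : IsRegionPartition S.net R
  boundary_eq : boundary S.net R = B
  valid : ∀ k, ValidOn S.net (R k) (dInf S.net R) S.d

theorem LoopInv.le_dInf {B : Set V} {S : AlgState V} (h : LoopInv R B S) {v : V}
    (hv : v ≠ S.net.s ∧ v ≠ S.net.t) : S.d v ≤ dInf S.net R := by
  obtain ⟨k, -⟩ := (h.part.2 v).2 hv
  exact (h.valid k).le_max v hv.1 hv.2

theorem exists_fusedLabels {N : Network V} (hR : IsRegionPartition N R) (d : V → ℕ)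
    (dk : Fin K → V → ℕ) : ∃ d', FusedLabels R d dk d' := by
  classical
  refine ⟨fun v => if h : ∃ k, v ∈ R k then dk h.choose v else d v, ?_, ?_⟩
  · intro k v hv
    have h : ∃ k, v ∈ R k := ⟨k, hv⟩
    have hk : h.choose = k := by
      by_contra hne
      exact Set.disjoint_left.1 (hR.1 _ _ hne) h.choose_spec hv
    simp only [dif_pos h, hk]
  · intro v hv
    exact dif_neg (not_exists.2 hv)

theorem exists_fusedFlow {N : Network V} (hR : IsRegionPartition N R) (d' : V → ℕ)
    (fk : Fin K → V → V → ℤ) : ∃ f', FusedFlow N R d' fk f' := by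
  classical
  let r : V → Option (Fin K) := fun v => if h : ∃ k, v ∈ R k then some h.choose else none
  have hr : ∀ k, ∀ v ∈ R k, r v = some k := by
    intro k v hv
    have h : ∃ k, v ∈ R k := ⟨k, hv⟩
    have hk : h.choose = k := by
      by_contra hne
      exact Set.disjoint_left.1 (hR.1 _ _ hne) h.choose_spec hv
    simp only [r, dif_pos h, hk]
  have hr' : ∀ v, v = N.s ∨ v = N.t → r v = none := by
    intro v hv
    refine dif_neg fun h => ?_
    have := (hR.2 v).1 h
    tauto
  refine ⟨fun u v => match r u, r v with
    | some k, some j => if k = j then fk k u v else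
        validPair d' v u * fk k u v + validPair d' u v * fk j u v
    | some k, none => fk k u v
    | none, some k => fk k u v
    | none, none => 0, ?_, ?_, ?_, ?_⟩
  · intro k j hkj u hu v hv
    simp [hr k u hu, hr j v hv, hkj]
  · intro k u hu v hv
    simp [hr k u hu, hr k v hv]
  · intro k u hu v hv
    simp [hr k u hu, hr' v hv]
  · intro u v hu hv
    simp [hr' u hu, hr' v hv]

variable [Fintype V]

theorem Sweep.exists_fusion {B : Set V} {S S' : AlgState V} (h : LoopInv R B S)
    (hs : Sweep R S S') : ∃ fk dk f' d', Fusion S.net R (dInf S.net R) S.d fk dk f' d' ∧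
      S'.net = S.net.residual f' ∧ GlobalGap (dInf S.net R) d' S'.d := by
  obtain ⟨fk, dk, f', d', h1, h2, h3, h4, h5⟩ := hs
  exact ⟨fk, dk, f', d', ⟨h.part, h.valid, fun k => (h1 k).spec (h.valid k), h2, h3⟩, h4, h5⟩

theorem LoopInv.sweep {B : Set V} {S S' : AlgState V} (h : LoopInv R B S) (hs : Sweep R S S') :
    LoopInv R B S' := by
  obtain ⟨fk, dk, f', d', H, h1, h2⟩ := hs.exists_fusion h
  obtain ⟨N', d''⟩ := S'
  obtain rfl : N' = _ := h1
  exact ⟨h.part, h.boundary_eq, fun k => (H.validOn k).globalGap h2⟩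

theorem loopInv_initState {N : Network V} (hN : N.Nonneg) (hR : IsRegionPartition N R) :
    LoopInv R (boundary N R) (initState N R) := by
  have hne : ∀ k, ∀ v ∈ R k, v ≠ N.s ∧ v ≠ N.t := fun k v hv => (hR.2 v).1 ⟨k, hv⟩
  have hd : ∀ v, v ≠ N.s → (initState N R).d v = 0 := fun v hv => if_neg hv
  refine ⟨hR, rfl, fun k => ⟨fun h => (hne k _ h).1 rfl, fun h => (hne k _ h).2 rfl, ?_, ?_, ?_, ?_,
    ?_, ?_, ?_⟩⟩
  · intro u v hE
    have hE' : N.E u v := hE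
    have h1 := hN.1 u v hE'
    have h2 := hN.1 v u (N.symm _ _ hE')
    change 0 ≤ N.c u v - saturate N u v
    unfold saturate
    split_ifs <;> omega
  · intro v hv
    refine add_nonneg (hN.2 v (hne k v hv).1 (hne k v hv).2) (Finset.sum_nonneg fun u hu => ?_)
    have hE : N.E u v := by simpa using hu
    have h1 := hN.1 u v hE
    unfold saturate
    rw [if_neg (fun h : v = N.s ∧ u ≠ N.s ∧ N.E v u => (hne k v hv).1 h.1)]
    split_ifs
    · exact h1
    · exact le_rfl
  · intro v hv hE
    have hE' : N.E N.s v := hE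
    change N.c N.s v - saturate N N.s v = 0
    rw [saturate, if_pos ⟨rfl, hv, hE'⟩, sub_self]
  · intro v hs _
    rw [hd v hs]; exact Nat.zero_le _
  · intro u hu v _ _
    rw [hd u (hne k u hu).1]; exact Nat.zero_le _
  · intro u hu v _ _
    rw [hd u (hne k u hu).1]; exact Nat.zero_le _
  · intro u hu _
    exact hd u (hne k u hu).1

theorem LoopInv.active_mem_boundary {B : Set V} {S S' : AlgState V} (h : LoopInv R B S)
    (hs : Sweep R S S') (x : V) (hxs : x ≠ S'.net.s) (hxt : x ≠ S'.net.t) (he : 0 < S'.net.e x)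
    (hd : S'.d x < dInf S'.net R) : x ∈ boundary S'.net R := by
  obtain ⟨fk, dk, f', d', H, h1, h2⟩ := hs.exists_fusion h
  obtain ⟨N', d''⟩ := S'
  obtain rfl : N' = _ := h1
  refine H.mem_boundary_of_active hxs hxt he ?_
  have h3 := h2.eq_of_lt hd
  exact h3 ▸ hd

/-- The fused objects are well defined because the regions are disjoint; the gap heuristic is
skipped. -/
theorem LoopInv.exists_sweep {B : Set V} {S : AlgState V} (h : LoopInv R B S) :
    ∃ S', Sweep R S S' := by
  choose fk hfk using fun k => (h.valid k).exists_ardStages (dInf S.net R + 1) le_rfl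
  obtain ⟨d', hd'⟩ := exists_fusedLabels h.part S.d
    (fun k => regionRelabel S.net (R k) (dInf S.net R) S.d (fk k))
  obtain ⟨f', hf'⟩ := exists_fusedFlow h.part d' fk
  exact ⟨⟨S.net.residual f', d'⟩, fk, _, f', d', fun k => ⟨hfk k, rfl⟩, hd', hf', rfl, Or.inl rfl⟩

theorem LoopInv.eligible_step {B : Set V} {S S' : AlgState V} (h : LoopInv R B S)
    (hD : 0 < dInf S.net R) (hs : Sweep R S S')
    (hact : ∀ x, x ≠ S.net.s → x ≠ S.net.t → 0 < S.net.e x → S.d x < dInf S.net R →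
      x ∈ boundary S.net R)
    {v : V} (hv : Eligible S'.net R (dInf S'.net R) S'.d v) :
    ∃ x, Eligible S.net R (dInf S.net R) S.d x ∧
      S'.d v + 1 + labelSum S.net R S.d ≤ S.d x + labelSum S'.net R S'.d := by
  obtain ⟨fk, dk, f', d', H, h1, h2⟩ := hs.exists_fusion h
  obtain ⟨N', d''⟩ := S'
  obtain rfl : N' = _ := h1
  exact H.eligible_step h2 hD hact hv

theorem sweeps_le {B : Set V} {σ : ℕ → AlgState V} {n : ℕ} (h0 : LoopInv R B (σ 0))
    (hσ : ∀ i < n, LoopStep R (σ i) (σ (i + 1))) : n ≤ B.ncard ^ 2 + B.ncard + 1 := by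
  rcases Nat.lt_or_ge n 2 with hn | hn
  · have : 0 ≤ B.ncard ^ 2 + B.ncard := Nat.zero_le _
    omega
  have hinv : ∀ i ≤ n, LoopInv R B (σ i) := by
    intro i
    induction i with
    | zero => exact fun _ => h0
    | succ i ih => exact fun hi => (ih (by omega)).sweep (hσ i hi).2
  have hD : ∀ i ≤ n, dInf (σ i).net R = B.ncard := fun i hi => by
    rw [dInf, (hinv i hi).boundary_eq]
  -- The count starts after the first sweep, because initially active vertices need not lie in the
  -- boundary.
  have hmain : ∀ i, i + 1 ≤ n → ∀ x, Eligible (σ (i + 1)).net R B.ncard (σ (i + 1)).d x →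
      i + (σ (i + 1)).d x ≤ labelSum (σ (i + 1)).net R (σ (i + 1)).d + B.ncard := by
    intro i
    induction i with
    | zero =>
      rintro hi x ⟨k, hk, -⟩
      have h1 := hinv _ hi
      have := h1.le_dInf ((h1.part.2 x).1 ⟨k, hk⟩)
      rw [hD _ hi] at this
      omega
    | succ i ih =>
      intro hi x hx
      obtain ⟨⟨y, -, -, -, hy⟩, hs⟩ := hσ (i + 1) hi
      rw [← hD _ hi] at hx
      obtain ⟨z, hz, hle⟩ := (hinv (i + 1) (by omega)).eligible_step (by omega) hs
        ((hinv i (by omega)).active_mem_boundary (hσ i (by omega)).2) hx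
      rw [hD _ (by omega)] at hz
      have := ih (by omega) z hz
      omega
  obtain ⟨m, rfl⟩ : ∃ m, n = m + 2 := ⟨n - 2, by omega⟩
  obtain ⟨y, hys, hyt, hye, hyd⟩ := (hσ (m + 1) (by omega)).1
  have h1 := hinv (m + 1) (by omega)
  have hyB := (hinv m (by omega)).active_mem_boundary (hσ m (by omega)).2 y hys hyt hye hyd
  -- The active vertex `y` has label below `D` and lies in the boundary, so the label sum is
  -- strictly below `D²`.
  have h2 := labelSum_lt hyB hyd fun v hv => h1.le_dInf (ne_of_mem_boundary hv)
  obtain ⟨k, hk⟩ := (h1.part.2 y).2 ⟨hys, hyt⟩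
  rw [hD _ (by omega)] at h2 hyd
  have h3 := hmain m (by omega) y ⟨k, hk, hye, Or.inl hyd⟩
  omega

end Algorithm

end PARD

theorem mainTheorem2 {V : Type*} [Fintype V] (N : PARD.Network V) (hN : N.Nonneg)
    {K : ℕ} (R : Fin K → Set V) (hR : PARD.IsRegionPartition N R) :
    -- every execution makes at most `2|𝓑|² + 1` sweeps
    (∀ (n : ℕ) (σ : ℕ → PARD.AlgState V), σ 0 = PARD.initState N R →
      (∀ i < n, PARD.LoopStep R (σ i) (σ (i + 1))) →
      n ≤ 2 * (PARD.boundary N R).ncard ^ 2 + 1) ∧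
    -- and every sweep terminates: no augmentation loop runs forever, and a next state is reached
    (∀ S : PARD.AlgState V,
      Relation.ReflTransGen (PARD.LoopStep R) (PARD.initState N R) S → PARD.HasActive R S →
      (∀ k : Fin K, ∀ j ≤ (PARD.boundary N R).ncard, ∀ f : V → V → ℤ,
        PARD.ARDStages S.net (R k) S.d j f →
        PARD.AugmentTerminates (S.net.region (R k)) (R k) (PARD.target S.net (R k) S.d j) f) ∧
      ∃ S' : PARD.AlgState V, PARD.Sweep R S S') := by
  have h0 := PARD.loopInv_initState hN hR
  refine ⟨?_, ?_⟩
  · rintro n σ hσ0 hσ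
    have h1 := PARD.sweeps_le (hσ0 ▸ h0) hσ
    rcases Nat.eq_zero_or_pos (PARD.boundary N R).ncard with h2 | h2
    · rw [h2] at h1 ⊢
      omega
    · nlinarith
  · intro S hS _
    have h1 : PARD.LoopInv R (PARD.boundary N R) S := by
      induction hS with
      | refl => exact h0
      | tail _ hs ih => exact (ih hs.1).sweep hs.2
    have hD : PARD.dInf S.net R = (PARD.boundary N R).ncard := by
      rw [PARD.dInf, h1.boundary_eq]
    refine ⟨?_, h1.exists_sweep⟩
    intro k j hj f hf
    rw [← hD] at hj
    exact (hf.stageInv (h1.valid k) (by omega)).augmentTerminates (h1.valid k) hj
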